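/- Let $\mathcal X$ be a measurable space, $p\ge 1$, $\mathcal D=\mathcal X\times[p]\times\{-1,1\}$, and let $\mu$ be a probability measure on $\mathcal D$. Let $\mathcal F$ be a real reproducing kernel Hilbert space of functions $f:\mathcal X\to\mathbb R$ with norm $\|\cdot\|_k$ and kernel $k$ such that $k(x,x)\le\kappa^2<\infty$ for all $x\in\mathcal X$. For $f\in\mathcal F$ and $s=(x,z,y)\in\mathcal D$ let $L(f,s)=\ell(f(x),y)$, where $\ell:\mathbb R\times\{-1,1\}\to\mathbb R$ is $\sigma$-admissible, i.e. $|\ell(f(x),y)-\ell(f'(x'),y)|\le\sigma|f(x)-f'(x')|$ for all $f,f'\in\mathcal F$, $x,x'\in\mathcal X$, $y\in\{-1,1\}$, and assume that $f\mapsto L(f,s)$ is convex and differentiable on $\mathcal F$ for every $s\in\mathcal D$. Let $\Omega:\mathcal F\to\mathbb R^a$ be a (coordinatewise) convex function, the same for all training sets, let $\lambda>0$, $N\ge1$, and let $\mathcal A:\mathcal D^N\to\mathcal F$, $S\mapsto\mathcal A_S$, be an algorithm such that for every $S=(s_1,\dots,s_N)\in\mathcal D^N$ the classifier $\mathcal A_S$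 is a minimizer of $$\frac1N\sum_{i=1}^N L(f,s_i)+\lambda\|f\|_k^2\quad\text{over all } f\in\mathcal F \text{ with } \Omega(f)\le 0 .$$ Assume that $(S,x)\mapsto\mathcal A_S(x)$ is measurable. Write $R(f)=\mathbb E_{s\sim\mu}[L(f,s)]$ and, for a training set $S$, $E(f)=\frac1N\sum_{i=1}^N L(f,s_i)$. Then $\mathcal A$ is $\frac{\sigma^2\kappa^2}{\lambda N}$-uniformly stable, i.e. $\sup_{s\in\mathcal D}|L(\mathcal A_S,s)-L(\mathcal A_{S'},s)|\le\frac{\sigma^2\kappa^2}{\lambda N}$ whenever $S,S'\in\mathcal D^N$ differ in at most one sample, and the following hold. 1. The risks $R(\mathcal A_S)$ are expectations of integrable functions, $R(\mathcal A_S)-E(\mathcal A_S)$ is integrable with respect to $S\sim\mu^N$, and $$\mathbb E_{S\sim\mu^N}\left[R(\mathcal A_S)-E(\mathcal A_S)\right]\le\frac{\sigma^2\kappa^2}{\lambda N}.$$ 2. If in addition the loss of the learned classifiers takes values in $[0,1]$, i.e. $L(\mathcal A_S,s)\in[0,1]$ for all $S\in\mathcal D^N$ and $s\in\mathcal D$,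 then for every $\delta\in(0,1)$, with probability at least $1-\delta$ over $S\sim\mu^N$, $$R(\mathcal A_S)\le E(\mathcal A_S)+8\sqrt{\left(\frac{2\sigma^2\kappa^2}{\lambda N}+\frac1N\right)\ln(8/\delta)}.$$ -/

import Mathlib

open MeasureTheory

noncomputable section

namespace StableFair

/-- The label set `{-1, 1}`. -/
abbrev Label : Type := ({-1, 1} : Set ℤ)

/-- The domain `𝒟 = 𝒳 × [p] × {-1, 1}`: a sample is a triple `(x, z, y)` consisting of a feature
vector, a sensitive attribute and a label. -/
abbrev Sample (X : Type*) (p : ℕ) : Type _ := X × Fin p × Label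

section RKHS

variable {X H : Type*} [NormedAddCommGroup H] [InnerProductSpace ℝ H] [RKHS ℝ H X ℝ] {p N : ℕ}

/-- The real-valued reproducing kernel `k(x, x')` of a reproducing kernel Hilbert space `H` of
real-valued functions. (Mathlib's kernel is operator valued; for scalar functions its entries are
linear maps `ℝ → ℝ`, that is, multiplications by `k(x, x')`.) -/
def scalarKernel (H : Type*) [NormedAddCommGroup H] [InnerProductSpace ℝ H] [CompleteSpace H]
    [RKHS ℝ H X ℝ] (x x' : X) : ℝ :=
  RKHS.kernel H x x' 1

/-- `L(f, s) = ℓ(f(x), y)` for a classifier `f` and a sample `s = (x, z, y)`. -/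
def loss (ℓ : ℝ → Label → ℝ) (f : H) (s : Sample X p) : ℝ :=
  ℓ (f s.1) s.2.2

/-- The expected risk `R(f) = 𝔼_{s ∼ μ} L(f, s)`. -/
def risk [MeasurableSpace X] (ℓ : ℝ → Label → ℝ) (μ : Measure (Sample X p)) (f : H) : ℝ :=
  ∫ s, loss ℓ f s ∂μ

/-- The empirical risk `E(f) = (1/N) ∑ᵢ L(f, sᵢ)` on the training set `S = (s₁, …, s_N)`. -/
def empRisk (ℓ : ℝ → Label → ℝ) (S : Fin N → Sample X p) (f : H) : ℝ :=
  (1 / (N : ℝ)) * ∑ i, loss ℓ f (S i)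

/-- `f` is a minimizer of the program
`min (1/N) ∑ᵢ L(f, sᵢ) + lam ‖f‖²` over all `f ∈ H` with `Ω(f) ≤ 0` (coordinatewise). -/
def IsStableFairMinimizer {a : ℕ} (ℓ : ℝ → Label → ℝ) (Ω : H → Fin a → ℝ) (lam : ℝ)
    (S : Fin N → Sample X p) (f : H) : Prop :=
  Ω f ≤ 0 ∧ ∀ g : H, Ω g ≤ 0 →
    empRisk ℓ S f + lam * ‖f‖ ^ 2 ≤ empRisk ℓ S g + lam * ‖g‖ ^ 2

/-- `ℓ(·, y)` is `σ`-Lipschitz on the set of all values taken by the classifiers in `H`. -/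
def IsAdmissible (H : Type*) {X : Type*} [NormedAddCommGroup H] [InnerProductSpace ℝ H]
    [RKHS ℝ H X ℝ] (ℓ : ℝ → Label → ℝ) (σ : ℝ) : Prop :=
  ∀ (f f' : H) (x x' : X) (y : Label), |ℓ (f x) y - ℓ (f' x') y| ≤ σ * |f x - f' x'|

/-- The algorithm `A`, mapping training sets of size `N` to classifiers, is `β`-uniformly stable:
replacing one sample of the training set changes the loss at every point by at most `β`. -/
def UniformlyStable (ℓ : ℝ → Label → ℝ) (A : (Fin N → Sample X p) → H) (β : ℝ) : Prop :=
  ∀ (i : Fin N) (S S' : Fin N → Sample X p), (∀ j, j ≠ i → S' j = S j) →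
    ∀ s : Sample X p, |loss ℓ (A S) s - loss ℓ (A S') s| ≤ β

end RKHS

end StableFair

end

/-! Stability comes from the quadratic growth of the regularized objective
(`IsStableFairMinimizer.add_le`). The feasible set does not depend on the data, so each of the two
minimizers competes in the other's program. Adding both growth inequalities leaves only the
exchanged sample: `2λd² ≤ (2/N)|σ||κ|d`, where `d` is the distance between the minimizers.

Both bounds on the gap `G` come from one exchange argument, `integral_genGap_mul_le`, which bounds
`E[G w]` for a weight `w(S)`. Taking `w = 1` gives the expectation. Taking `w = exp(tG)` bounds the
derivative of the cumulant generating function of `G`; integrating it from `0` and applying Chernoff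
gives the tail. The result is of order `√(β + 1/N)`, where bounded differences alone would give `(β
+ 1/N)√N`. -/

namespace StableFair

/-! ### Generalization gap of a uniformly stable loss. -/

section GeneralizationGap

variable {Z : Type*} [MeasurableSpace Z] {N : ℕ}

/-- Exchanging a fresh sample with the `i`-th training sample preserves the product measure. -/
theorem measurePreserving_swap_update (μ : Measure Z) [IsProbabilityMeasure μ] (i : Fin N) :
    MeasurePreserving
      (fun q : Z × (Fin N → Z) => (q.2 i, Function.update q.2 i q.1))
      (μ.prod (Measure.pi fun _ : Fin N => μ)) (μ.prod (Measure.pi fun _ : Fin N => μ)) := by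
  -- In `Z^(N+1)`, with the fresh sample as coordinate `0`, the map is the transposition of `0` and
  -- `i.succ`.
  have he := measurePreserving_piFinSuccAbove (fun _ : Fin (N + 1) => μ) 0
  have hs := measurePreserving_arrowCongr' (fun _ : Fin (N + 1) => μ) (fun _ : Fin (N + 1) => μ)
    (Equiv.swap 0 i.succ) (MeasurableEquiv.refl Z) (fun _ => MeasurePreserving.id μ)
  have h := (he.comp hs).comp (he.symm _)
  convert h using 1
  funext q
  refine Prod.ext ?_ (funext fun j => ?_)
  · simp [MeasurableEquiv.piFinSuccAbove, MeasurableEquiv.arrowCongr', Equiv.arrowCongr']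
  · rcases eq_or_ne j i with rfl | hj
    · simp [MeasurableEquiv.piFinSuccAbove, MeasurableEquiv.arrowCongr', Equiv.arrowCongr',
        Fin.tail, Equiv.arrowCongr, Fin.consEquiv]
    · have : Equiv.swap 0 i.succ j.succ = j.succ :=
        Equiv.swap_apply_of_ne_of_ne (Fin.succ_ne_zero j) (by simpa using hj)
      simp [MeasurableEquiv.piFinSuccAbove, MeasurableEquiv.arrowCongr', Equiv.arrowCongr',
        Fin.tail, Equiv.arrowCongr, Fin.consEquiv, this, hj]

/-- The generalization gap `𝔼_z L(S, z) - (1/N) ∑ᵢ L(S, Sᵢ)` of a loss depending on the training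
set. -/
noncomputable def genGap (μ : Measure Z) (L : (Fin N → Z) → Z → ℝ) (S : Fin N → Z) : ℝ :=
  ∫ z, L S z ∂μ - (1 / (N : ℝ)) * ∑ i, L S (S i)

variable {μ : Measure Z} [IsProbabilityMeasure μ] {L : (Fin N → Z) → Z → ℝ}

theorem measurable_genGap (hL : Measurable (Function.uncurry L)) : Measurable (genGap μ L) := by
  have h1 : Measurable fun S => ∫ z, L S z ∂μ :=
    (hL.stronglyMeasurable.integral_prod_right (ν := μ)).measurable
  have h2 (i : Fin N) : Measurable fun S : Fin N → Z => L S (S i) :=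
    hL.comp (measurable_id.prodMk (measurable_pi_apply i))
  exact h1.sub ((Finset.measurable_sum _ fun i _ => h2 i).const_mul _)

theorem integrable_of_measurable_of_abs_le {Y : Type*} [MeasurableSpace Y] {ν : Measure Y}
    [IsFiniteMeasure ν] {f : Y → ℝ} (hf : Measurable f) {C : ℝ} (hC : ∀ y, |f y| ≤ C) :
    Integrable f ν :=
  .of_bound hf.aestronglyMeasurable C (.of_forall hC)

theorem abs_integral_le_of_abs_le {f : Z → ℝ} {C : ℝ} (hC : ∀ y, |f y| ≤ C) :
    |∫ z, f z ∂μ| ≤ C := by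
  simpa using norm_integral_le_of_norm_le_const (μ := μ) (f := f) (C := C) (.of_forall hC)

theorem abs_average_le (hN : 0 < N) {f : Fin N → ℝ} {C : ℝ} (hC : ∀ i, |f i| ≤ C) :
    |(1 / (N : ℝ)) * ∑ i, f i| ≤ C := by
  have hN' : (0 : ℝ) < N := by exact_mod_cast hN
  have h : |∑ i, f i| ≤ N * C :=
    (Finset.abs_sum_le_sum_abs _ _).trans ((Finset.sum_le_sum fun i _ => hC i).trans (by simp))
  rw [abs_mul, abs_of_pos (by positivity), one_div, inv_mul_le_iff₀ hN']
  exact h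

theorem abs_genGap_le (hN : 0 < N) {C : ℝ} (hC : ∀ S z, |L S z| ≤ C) (S : Fin N → Z) :
    |genGap μ L S| ≤ 2 * C := by
  have h1 := abs_integral_le_of_abs_le (μ := μ) (hC S)
  have h2 := abs_average_le hN fun i => hC S (S i)
  exact (abs_sub _ _).trans (by linarith)

/-- A weighted expectation of the generalization gap, bounded by exchanging training samples with
a fresh sample. -/
theorem integral_genGap_mul_le (hN : 0 < N) (hL : Measurable (Function.uncurry L)) {C : ℝ}
    (hC : ∀ S z, |L S z| ≤ C) {w : (Fin N → Z) → ℝ} (hw : Measurable w) {D : ℝ}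
    (hD : ∀ S, |w S| ≤ D) {c : ℝ}
    (h : ∀ i S z, L (Function.update S i z) (S i) * w (Function.update S i z) ≤
      (L S (S i) + c) * w S) :
    ∫ S, genGap μ L S * w S ∂(Measure.pi fun _ : Fin N => μ) ≤
      c * ∫ S, w S ∂(Measure.pi fun _ : Fin N => μ) := by
  set P : Measure (Fin N → Z) := Measure.pi fun _ : Fin N => μ with hP
  have hN' : (0 : ℝ) < N := by exact_mod_cast hN
  have hCD (S : Fin N → Z) (z : Z) : |L S z * w S| ≤ C * D := by
    rw [abs_mul]
    exact mul_le_mul (hC S z) (hD S) (abs_nonneg _) ((abs_nonneg _).trans (hC S z))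
  have hwi : Integrable w P := integrable_of_measurable_of_abs_le hw hD
  have hLw : Measurable fun q : Z × (Fin N → Z) => L q.2 q.1 * w q.2 :=
    (hL.comp (measurable_snd.prodMk measurable_fst)).mul (hw.comp measurable_snd)
  have hLwi : Integrable (fun q : Z × (Fin N → Z) => L q.2 q.1 * w q.2) (μ.prod P) :=
    integrable_of_measurable_of_abs_le hLw fun q => hCD q.2 q.1
  have hdi (i : Fin N) : Integrable (fun S => L S (S i) * w S) P :=
    integrable_of_measurable_of_abs_le
      ((hL.comp (measurable_id.prodMk (measurable_pi_apply i))).mul hw) fun S => hCD S (S i)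
  have hR : ∫ S, (∫ z, L S z ∂μ) * w S ∂P = ∫ q, L q.2 q.1 * w q.2 ∂(μ.prod P) := by
    rw [integral_prod_symm _ hLwi]
    simp only [integral_mul_const]
  have hRi : Integrable (fun S => (∫ z, L S z ∂μ) * w S) P := by
    have := hLwi.integral_prod_right
    simpa only [integral_mul_const] using this
  have key (i : Fin N) : ∫ S, (∫ z, L S z ∂μ) * w S ∂P ≤
      ∫ S, L S (S i) * w S ∂P + c * ∫ S, w S ∂P := by
    have hT := measurePreserving_swap_update μ i
    rw [← hP] at hT
    -- The exchange turns the test point into `S i`, at the price of updating `S`; `h` then undoes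
    -- the update.
    have h1 : ∫ q, L q.2 q.1 * w q.2 ∂(μ.prod P) = ∫ q : Z × (Fin N → Z),
        L (Function.update q.2 i q.1) (q.2 i) * w (Function.update q.2 i q.1) ∂(μ.prod P) := by
      conv_lhs => rw [← hT.map_eq]
      rw [integral_map hT.measurable.aemeasurable hLw.aestronglyMeasurable]
    have h2i : Integrable (fun S => L S (S i) * w S + c * w S) P := (hdi i).add (hwi.const_mul c)
    calc _ = _ := hR.trans h1
      _ ≤ ∫ q : Z × (Fin N → Z), (L q.2 (q.2 i) * w q.2 + c * w q.2) ∂(μ.prod P) := by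
          refine integral_mono (hT.integrable_comp_of_integrable hLwi) (h2i.comp_snd μ) fun q => ?_
          have := h i q.2 q.1
          dsimp only
          linarith
      _ = ∫ S, (L S (S i) * w S + c * w S) ∂P := by
          rw [integral_fun_snd (fun S => L S (S i) * w S + c * w S)]; simp
      _ = _ := by rw [integral_add (hdi i) (hwi.const_mul c), integral_const_mul]
  have hsplit : ∫ S, genGap μ L S * w S ∂P = ∫ S, (∫ z, L S z ∂μ) * w S ∂P -
      (1 / (N : ℝ)) * ∑ i, ∫ S, L S (S i) * w S ∂P := by
    rw [← integral_finsetSum _ fun i _ => hdi i, ← integral_const_mul, ← integral_sub hRi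
      ((integrable_finsetSum _ fun i _ => hdi i).const_mul _)]
    refine integral_congr_ae (.of_forall fun S => ?_)
    simp only [genGap, sub_mul, mul_assoc, Finset.sum_mul]
  rw [hsplit]
  have hsum := Finset.sum_le_sum fun i (_ : i ∈ Finset.univ) => key i
  rw [Finset.sum_add_distrib] at hsum
  simp only [Finset.sum_const, Finset.card_univ, Fintype.card_fin, nsmul_eq_mul] at hsum
  rw [sub_le_iff_le_add, ← mul_le_mul_iff_of_pos_left hN']
  refine hsum.trans (le_of_eq ?_)
  field_simp
  ring

/-- The expected generalization gap of a uniformly stable loss. -/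
theorem integral_genGap_le (hN : 0 < N) (hL : Measurable (Function.uncurry L)) {C : ℝ}
    (hC : ∀ S z, |L S z| ≤ C) {β : ℝ}
    (hβ : ∀ i S z s, |L (Function.update S i z) s - L S s| ≤ β) :
    ∫ S, genGap μ L S ∂(Measure.pi fun _ : Fin N => μ) ≤ β := by
  have := integral_genGap_mul_le (μ := μ) hN hL hC (w := fun _ => 1) measurable_const
    (D := 1) (by simp) (c := β) fun i S z => by
      have := le_of_abs_le (hβ i S z (S i))
      linarith
  simpa using this

/-- The risk and every summand of the empirical risk move by at most `β`. The `i`-th summand also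
changes its evaluation point, which costs at most `1` before averaging. -/
theorem abs_genGap_update_sub_le (hN : 0 < N) (hL : Measurable (Function.uncurry L))
    (h01 : ∀ S z, L S z ∈ Set.Icc (0 : ℝ) 1) {β : ℝ}
    (hβ : ∀ i S z s, |L (Function.update S i z) s - L S s| ≤ β) (i : Fin N) (S : Fin N → Z)
    (z : Z) : |genGap μ L (Function.update S i z) - genGap μ L S| ≤ 2 * β + 1 / N := by
  have hN' : (0 : ℝ) < N := by exact_mod_cast hN
  have hint (S : Fin N → Z) : Integrable (L S) μ :=
    integrable_of_measurable_of_abs_le (C := 1) (hL.comp measurable_prodMk_left) fun z =>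
      abs_le.2 ⟨by linarith [(h01 S z).1], (h01 S z).2⟩
  have h1 : |∫ s, L (Function.update S i z) s ∂μ - ∫ s, L S s ∂μ| ≤ β := by
    rw [← integral_sub (hint _) (hint _)]
    exact abs_integral_le_of_abs_le (hβ i S z)
  have h2 : |∑ j, L (Function.update S i z) (Function.update S i z j) - ∑ j, L S (S j)| ≤
      N * β + 1 := by
    rw [← Finset.sum_sub_distrib]
    refine (Finset.abs_sum_le_sum_abs _ _).trans ?_
    have hj (j : Fin N) : |L (Function.update S i z) (Function.update S i z j) - L S (S j)| ≤
        β + if j = i then 1 else 0 := by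
      split_ifs with hji
      · have ha := h01 S (Function.update S i z j)
        have hb := h01 S (S j)
        have hc := abs_le.1 (hβ i S z (Function.update S i z j))
        rw [abs_le]
        constructor <;> linarith [ha.1, ha.2, hb.1, hb.2, hc.1, hc.2]
      · rw [Function.update_of_ne hji, add_zero]
        exact hβ i S z (S j)
    refine (Finset.sum_le_sum fun j _ => hj j).trans (le_of_eq ?_)
    simp [Finset.sum_add_distrib]
  have h3 : |(1 / (N : ℝ)) * (∑ j, L (Function.update S i z) (Function.update S i z j) -
      ∑ j, L S (S j))| ≤ β + 1 / N := by
    rw [abs_mul, abs_of_pos (by positivity), one_div, inv_mul_le_iff₀ hN']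
    refine h2.trans (le_of_eq ?_)
    field_simp
  have : genGap μ L (Function.update S i z) - genGap μ L S =
      (∫ s, L (Function.update S i z) s ∂μ - ∫ s, L S s ∂μ) -
      (1 / (N : ℝ)) * (∑ j, L (Function.update S i z) (Function.update S i z j) -
        ∑ j, L S (S j)) := by
    simp only [genGap]; ring
  rw [this]
  exact (abs_sub _ _).trans (by linarith)

open ProbabilityTheory in
/-- The cumulant generating function of the generalization gap of a uniformly stable loss. -/
theorem cgf_genGap_le (hN : 0 < N) (hL : Measurable (Function.uncurry L))
    (h01 : ∀ S z, L S z ∈ Set.Icc (0 : ℝ) 1) {β : ℝ}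
    (hβ : ∀ i S z s, |L (Function.update S i z) s - L S s| ≤ β) (hβ0 : 0 ≤ β)
    {η : ℝ} (hη : 0 ≤ η) :
    cgf (genGap μ L) (Measure.pi fun _ : Fin N => μ) η ≤
      η * (Real.exp (η * (2 * β + 1 / N)) * (1 + β) - 1) := by
  set P : Measure (Fin N → Z) := Measure.pi fun _ : Fin N => μ with hP
  have hC (S : Fin N → Z) (z : Z) : |L S z| ≤ 1 :=
    abs_le.2 ⟨by linarith [(h01 S z).1], (h01 S z).2⟩
  have hG : Measurable (genGap μ L) := measurable_genGap hL
  have hGb (S : Fin N → Z) : |genGap μ L S| ≤ 2 := by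
    simpa using abs_genGap_le (μ := μ) hN hC S
  have hwm (t : ℝ) : Measurable fun S => Real.exp (t * genGap μ L S) :=
    Real.measurable_exp.comp (hG.const_mul t)
  have hwb (t : ℝ) (S : Fin N → Z) : |Real.exp (t * genGap μ L S)| ≤ Real.exp (|t| * 2) := by
    rw [Real.abs_exp, Real.exp_le_exp]
    refine (le_abs_self _).trans ?_
    rw [abs_mul]
    exact mul_le_mul_of_nonneg_left (hGb S) (abs_nonneg t)
  have hset : integrableExpSet (genGap μ L) P = Set.univ :=
    Set.eq_univ_of_forall fun t => integrable_of_measurable_of_abs_le (hwm t) (hwb t)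
  have hmem (t : ℝ) : t ∈ interior (integrableExpSet (genGap μ L) P) := by simp [hset]
  -- `G` is bounded, so all exponential moments are finite.
  have hdiff : Differentiable ℝ (cgf (genGap μ L) P) := fun t =>
    (analyticAt_cgf (hmem t)).differentiableAt
  set Δ : ℝ := 2 * β + 1 / N with hΔ
  have hΔ0 : 0 ≤ Δ := by positivity
  have hderiv (t : ℝ) (ht : t ∈ interior (Set.Icc 0 η)) :
      deriv (cgf (genGap μ L) P) t ≤ Real.exp (η * Δ) * (1 + β) - 1 := by
    rw [interior_Icc] at ht
    rw [deriv_cgf (hmem t), div_le_iff₀ (mgf_pos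
      (integrable_of_measurable_of_abs_le (hwm t) (hwb t)))]
    have := integral_genGap_mul_le (μ := μ) hN hL hC (hwm t) (hwb t)
      (c := Real.exp (t * Δ) * (1 + β) - 1) fun i S z => by
        have h1 := le_of_abs_le (hβ i S z (S i))
        have h2 := le_of_abs_le (abs_genGap_update_sub_le (μ := μ) hN hL h01 hβ i S z)
        rw [← hΔ] at h2
        have h3 : Real.exp (t * genGap μ L (Function.update S i z)) ≤
            Real.exp (t * Δ) * Real.exp (t * genGap μ L S) := by
          rw [← Real.exp_add, Real.exp_le_exp]
          nlinarith [ht.1]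
        have h4 : 1 ≤ Real.exp (t * Δ) := Real.one_le_exp (mul_nonneg ht.1.le hΔ0)
        have h5 := (h01 S (S i)).1
        have h6 := (h01 S (S i)).2
        calc _ ≤ (L S (S i) + β) * (Real.exp (t * Δ) * Real.exp (t * genGap μ L S)) :=
              mul_le_mul (by linarith) h3 (Real.exp_pos _).le (by linarith)
          _ = ((L S (S i) + β) * Real.exp (t * Δ)) * Real.exp (t * genGap μ L S) := by ring
          _ ≤ _ := by
              -- Since `L ≤ 1 ≤ exp (t * Δ)`, one has `L * (exp (t * Δ) - 1) ≤ exp (t * Δ) - 1`.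
              refine mul_le_mul_of_nonneg_right ?_ (Real.exp_pos _).le
              nlinarith
    refine this.trans (mul_le_mul_of_nonneg_right ?_ mgf_nonneg)
    have : Real.exp (t * Δ) ≤ Real.exp (η * Δ) :=
      Real.exp_le_exp.2 (mul_le_mul_of_nonneg_right ht.2.le hΔ0)
    nlinarith
  have := (convex_Icc (0 : ℝ) η).image_sub_le_mul_sub_of_deriv_le hdiff.continuous.continuousOn
    hdiff.differentiableOn hderiv 0 ⟨le_rfl, hη⟩ η ⟨hη, le_rfl⟩ hη
  rw [cgf_zero, sub_zero, sub_zero] at this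
  linarith

open ProbabilityTheory in
/-- High-probability bound for the generalization gap of a uniformly stable loss. -/
theorem one_sub_le_measureReal_genGap_le (hN : 0 < N) (hL : Measurable (Function.uncurry L))
    (h01 : ∀ S z, L S z ∈ Set.Icc (0 : ℝ) 1) {β : ℝ}
    (hβ : ∀ i S z s, |L (Function.update S i z) s - L S s| ≤ β) (hβ0 : 0 ≤ β)
    {δ : ℝ} (hδ : 0 < δ) (hδ1 : δ < 1) :
    1 - δ ≤ (Measure.pi fun _ : Fin N => μ).real
      {S | genGap μ L S ≤ 8 * √((2 * β + 1 / N) * Real.log (8 / δ))} := by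
  set P : Measure (Fin N → Z) := Measure.pi fun _ : Fin N => μ with hP
  have hN' : (0 : ℝ) < N := by exact_mod_cast hN
  set Δ : ℝ := 2 * β + 1 / N with hΔ
  have hΔ0 : 0 < Δ := by positivity
  set Λ : ℝ := Real.log (8 / δ) with hΛ
  have hΛ2 : 2 ≤ Λ := by
    have h8 : Real.log 8 = 3 * Real.log 2 := by
      rw [show (8 : ℝ) = 2 ^ 3 by norm_num, Real.log_pow]; norm_num
    have : Real.log 8 ≤ Λ := Real.log_le_log (by norm_num) (by
      rw [le_div_iff₀ hδ]; linarith)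
    linarith [Real.log_two_gt_d9]
  have hexp : Real.exp (-Λ) ≤ δ := by
    rw [hΛ, Real.exp_neg, Real.exp_log (by positivity), inv_div]
    linarith
  set u : ℝ := √(Δ * Λ) with hu
  have hu0 : 0 < u := Real.sqrt_pos.2 (by positivity)
  have husq : u * u = Δ * Λ := Real.mul_self_sqrt (by positivity)
  -- A gap of a `[0, 1]`-valued loss never exceeds `1`, so only `u < 1/8` matters.
  rcases le_or_gt 1 (8 * u) with h1 | h1
  · have hall : {S | genGap μ L S ≤ 8 * u} = Set.univ := by
      refine Set.eq_univ_of_forall fun S => ?_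
      have hi : ∫ z, L S z ∂μ ≤ 1 :=
        le_of_abs_le <| abs_integral_le_of_abs_le fun z =>
          abs_le.2 ⟨by linarith [(h01 S z).1], (h01 S z).2⟩
      have hs : 0 ≤ (1 / (N : ℝ)) * ∑ i, L S (S i) :=
        mul_nonneg (by positivity) (Finset.sum_nonneg fun i _ => (h01 S (S i)).1)
      simp only [Set.mem_ofPred_eq, genGap]
      linarith
    rw [hall]
    simp [hδ.le]
  · have hG : Measurable (genGap μ L) := measurable_genGap hL
    have hint (t : ℝ) : Integrable (fun S => Real.exp (t * genGap μ L S)) P := by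
      refine integrable_of_measurable_of_abs_le (Real.measurable_exp.comp (hG.const_mul t))
        (C := Real.exp (|t| * (2 * 1))) fun S => ?_
      rw [Real.abs_exp, Real.exp_le_exp]
      refine (le_abs_self _).trans ?_
      rw [abs_mul]
      exact mul_le_mul_of_nonneg_left (abs_genGap_le hN (fun S z =>
        abs_le.2 ⟨by linarith [(h01 S z).1], (h01 S z).2⟩) S) (abs_nonneg t)
    -- With this choice `η * Δ = u` and `η * u = Λ`; the Chernoff exponent is at most `2Λ - 8Λ ≤
    -- -Λ`.
    set η : ℝ := u / Δ with hη
    have hη0 : 0 < η := by positivity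
    have hηΔ : η * Δ = u := by rw [hη]; field_simp
    have hηu : η * u = Λ := by rw [hη, div_mul_eq_mul_div, husq]; field_simp
    have hcgf := cgf_genGap_le (μ := μ) hN hL h01 hβ hβ0 hη0.le
    rw [← hΔ, hηΔ] at hcgf
    have hexpu : Real.exp u ≤ 1 + u + u ^ 2 := by
      have := (abs_le.1 (Real.abs_exp_sub_one_sub_id_le (x := u)
        (by rw [abs_of_pos hu0]; linarith))).2
      linarith
    -- From `2β ≤ Δ` and `2 ≤ Λ`.
    have hβΔ : β ≤ u ^ 2 / 4 := by
      have : 0 < 1 / (N : ℝ) := by positivity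
      nlinarith
    have hc : Real.exp u * (1 + β) - 1 ≤ 2 * u := by
      have : Real.exp u * (1 + β) ≤ (1 + u + u ^ 2) * (1 + u ^ 2 / 4) :=
        mul_le_mul hexpu (by linarith) (by linarith) (by positivity)
      have hu2 : u ^ 2 ≤ u / 8 := by nlinarith
      have hu4 : (1 + u + u ^ 2) * (u ^ 2 / 4) ≤ 2 * (u / 8) :=
        mul_le_mul (by nlinarith) (by linarith) (by positivity) (by norm_num)
      nlinarith
    have htail := measure_ge_le_exp_cgf (μ := P) (X := genGap μ L) (8 * u) hη0.le (hint η)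
    have htail' : P.real {S | 8 * u ≤ genGap μ L S} ≤ δ := by
      refine htail.trans ((Real.exp_le_exp.2 ?_).trans hexp)
      have h2 : η * (Real.exp u * (1 + β) - 1) ≤ η * (2 * u) :=
        mul_le_mul_of_nonneg_left hc hη0.le
      nlinarith
    have hcompl : {S | genGap μ L S ≤ 8 * u}ᶜ ⊆ {S | 8 * u ≤ genGap μ L S} := fun S hS =>
      (not_le.1 (Set.notMem_ofPred_iff.1 hS)).le
    have hle := (measureReal_mono (μ := P) hcompl).trans htail'
    rw [probReal_compl_eq_one_sub (measurableSet_le hG measurable_const)] at hle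
    linarith

end GeneralizationGap

end StableFair

namespace StableFair

/-! ### Stability, boundedness and measurability of the regularized minimizer's loss. -/

section Stability

variable {X H : Type*} [NormedAddCommGroup H] [InnerProductSpace ℝ H]
  [RKHS ℝ H X ℝ] {p N a : ℕ} {κ σ lam : ℝ} {ℓ : ℝ → Label → ℝ}

/-- Reproducing property and Cauchy–Schwarz; `|κ|` appears because `κ` has no sign. -/
theorem abs_apply_le [CompleteSpace H] (hκ : ∀ x : X, scalarKernel H x x ≤ κ ^ 2) (f : H) (x : X) :
    |f x| ≤ |κ| * ‖f‖ := by
  have h1 : ‖RKHS.kerFun H x 1‖ ^ 2 ≤ κ ^ 2 := by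
    have := RKHS.kernel_inner (𝕜 := ℝ) H x x (1 : ℝ) (1 : ℝ)
    rw [real_inner_self_eq_norm_sq] at this
    rw [← this]
    simpa [scalarKernel] using hκ x
  have h2 : inner ℝ f (RKHS.kerFun H x (1 : ℝ)) = f x := by
    rw [RKHS.inner_kerFun]; simp
  rw [← h2]
  refine (abs_real_inner_le_norm _ _).trans ?_
  rw [mul_comm]
  exact mul_le_mul_of_nonneg_right (by simpa using sq_le_sq.1 h1) (norm_nonneg _)

theorem IsAdmissible.abs_loss_sub_le [CompleteSpace H] (hσ : IsAdmissible H ℓ σ)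
    (hκ : ∀ x : X, scalarKernel H x x ≤ κ ^ 2) (f g : H) (s : Sample X p) :
    |loss ℓ f s - loss ℓ g s| ≤ |σ| * |κ| * ‖f - g‖ := by
  refine (hσ f g s.1 s.1 s.2.2).trans ?_
  have h := abs_apply_le hκ (f - g) s.1
  rw [RKHS.coe_sub, Pi.sub_apply] at h
  calc σ * |f s.1 - g s.1| ≤ |σ| * |f s.1 - g s.1| :=
        mul_le_mul_of_nonneg_right (le_abs_self σ) (abs_nonneg _)
    _ ≤ |σ| * (|κ| * ‖f - g‖) := mul_le_mul_of_nonneg_left h (abs_nonneg _)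
    _ = _ := by ring

theorem convexOn_empRisk
    (hconv : ∀ s : Sample X p, ConvexOn ℝ Set.univ (fun f : H => loss ℓ f s))
    (S : Fin N → Sample X p) : ConvexOn ℝ Set.univ (fun f : H => empRisk ℓ S f) := by
  have h (I : Finset (Fin N)) : ConvexOn ℝ Set.univ (fun f : H => ∑ i ∈ I, loss ℓ f (S i)) := by
    induction I using Finset.induction_on with
    | empty => simpa using convexOn_const (0 : ℝ) convex_univ
    | insert i I hi ih =>
      simp only [Finset.sum_insert hi]
      exact (hconv (S i)).add ih
  refine ((h Finset.univ).smul (c := 1 / (N : ℝ)) (by positivity)).congr fun f _ => ?_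
  simp [empRisk]

/-- The regularized objective grows quadratically away from its constrained minimizer. -/
theorem IsStableFairMinimizer.add_le
    (hconv : ∀ s : Sample X p, ConvexOn ℝ Set.univ (fun f : H => loss ℓ f s))
    {Ω : H → Fin a → ℝ} (hΩ : ConvexOn ℝ Set.univ Ω) {S : Fin N → Sample X p} {f g : H}
    (hf : IsStableFairMinimizer ℓ Ω lam S f) (hg : Ω g ≤ 0) :
    empRisk ℓ S f + lam * ‖f‖ ^ 2 + lam * ‖f - g‖ ^ 2 ≤ empRisk ℓ S g + lam * ‖g‖ ^ 2 := by
  -- Compare `f` with the feasible point `(1 - t) • f + t • g`, divide by `t`, then let `t → 0`.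
  have key (t : ℝ) (ht : t ∈ Set.Ioo (0 : ℝ) 1) :
      empRisk ℓ S f + lam * ‖f‖ ^ 2 + (1 - t) * (lam * ‖f - g‖ ^ 2) ≤
        empRisk ℓ S g + lam * ‖g‖ ^ 2 := by
    obtain ⟨ht0, ht1⟩ := ht
    have hmem : Ω ((1 - t) • f + t • g) ≤ 0 :=
      (hΩ.2 (Set.mem_univ f) (Set.mem_univ g) (by linarith) ht0.le (by ring)).trans
        (add_nonpos (smul_nonpos_of_nonneg_of_nonpos (by linarith) hf.1)
          (smul_nonpos_of_nonneg_of_nonpos ht0.le hg))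
    have hmin := hf.2 _ hmem
    have hE := (convexOn_empRisk hconv S).2 (Set.mem_univ f) (Set.mem_univ g)
      (by linarith : 0 ≤ 1 - t) ht0.le (by ring)
    simp only [smul_eq_mul] at hE
    have hnorm : ‖(1 - t) • f + t • g‖ ^ 2 =
        (1 - t) * ‖f‖ ^ 2 + t * ‖g‖ ^ 2 - t * (1 - t) * ‖f - g‖ ^ 2 := by
      rw [norm_add_sq_real, norm_sub_sq_real, norm_smul, norm_smul, mul_pow, mul_pow,
        inner_smul_left, inner_smul_right]
      simp only [Real.norm_eq_abs, sq_abs, conj_trivial]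
      ring
    rw [hnorm] at hmin
    have : t * (empRisk ℓ S f + lam * ‖f‖ ^ 2 + (1 - t) * (lam * ‖f - g‖ ^ 2)) ≤
        t * (empRisk ℓ S g + lam * ‖g‖ ^ 2) := by linarith
    exact le_of_mul_le_mul_left this ht0
  have hlim : Filter.Tendsto (fun t : ℝ =>
      empRisk ℓ S f + lam * ‖f‖ ^ 2 + (1 - t) * (lam * ‖f - g‖ ^ 2)) (nhdsWithin 0 (Set.Ioi 0))
      (nhds (empRisk ℓ S f + lam * ‖f‖ ^ 2 + (1 - 0) * (lam * ‖f - g‖ ^ 2))) :=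
    (Continuous.tendsto (by fun_prop) 0).mono_left nhdsWithin_le_nhds
  have := le_of_tendsto hlim
    (Filter.mem_of_superset (Ioo_mem_nhdsGT one_pos) key)
  linarith

theorem uniformlyStable_of_isStableFairMinimizer [CompleteSpace H] (hN : 0 < N) (hlam : 0 < lam)
    (hκ : ∀ x : X, scalarKernel H x x ≤ κ ^ 2) (hσ : IsAdmissible H ℓ σ)
    (hconv : ∀ s : Sample X p, ConvexOn ℝ Set.univ (fun f : H => loss ℓ f s))
    {Ω : H → Fin a → ℝ} (hΩ : ConvexOn ℝ Set.univ Ω) {A : (Fin N → Sample X p) → H}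
    (hA : ∀ S, IsStableFairMinimizer ℓ Ω lam S (A S)) :
    UniformlyStable ℓ A (σ ^ 2 * κ ^ 2 / (lam * N)) := by
  intro i S S' hS s
  have hN' : (0 : ℝ) < N := by exact_mod_cast hN
  set d := ‖A S - A S'‖ with hd
  set b := |σ| * |κ| with hb
  have hb0 : 0 ≤ b := by positivity
  have hd0 : 0 ≤ d := norm_nonneg _
  have h1 := (hA S).add_le hconv hΩ (hA S').1
  have h2 := (hA S').add_le hconv hΩ (hA S).1
  rw [norm_sub_rev, ← hd] at h2
  rw [← hd] at h1
  have hdiff (f : H) : empRisk ℓ S f - empRisk ℓ S' f =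
      1 / (N : ℝ) * (loss ℓ f (S i) - loss ℓ f (S' i)) := by
    rw [empRisk, empRisk, ← mul_sub, ← Finset.sum_sub_distrib,
      Finset.sum_eq_single i (fun j _ hj => by rw [hS j hj, sub_self]) (by simp)]
  have h3 := le_of_abs_le (hσ.abs_loss_sub_le hκ (A S') (A S) (S i))
  have h4 := le_of_abs_le (hσ.abs_loss_sub_le hκ (A S) (A S') (S' i))
  rw [norm_sub_rev, ← hd, ← hb] at h3
  rw [← hd, ← hb] at h4
  have h5 : 2 * (lam * d ^ 2) ≤ 1 / (N : ℝ) * (2 * (b * d)) := by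
    have e1 := hdiff (A S)
    have e2 := hdiff (A S')
    have : 1 / (N : ℝ) * ((loss ℓ (A S') (S i) - loss ℓ (A S) (S i)) +
        (loss ℓ (A S) (S' i) - loss ℓ (A S') (S' i))) ≤ 1 / (N : ℝ) * (2 * (b * d)) :=
      mul_le_mul_of_nonneg_left (by linarith) (by positivity)
    linarith
  have h6 : d ≤ b / (lam * N) := by
    rw [le_div_iff₀ (by positivity)]
    -- Cancelling `d` needs `d > 0`; for `d = 0` the bound is trivial.
    rcases hd0.eq_or_lt with h0 | h0
    · rw [← h0]; simpa using hb0
    · rw [one_div, le_inv_mul_iff₀ hN'] at h5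
      refine le_of_mul_le_mul_right ?_ h0
      linarith
  calc _ ≤ b * d := hσ.abs_loss_sub_le hκ _ _ s
    _ ≤ b * (b / (lam * N)) := mul_le_mul_of_nonneg_left h6 hb0
    _ = _ := by rw [← sq_abs σ, ← sq_abs κ, hb]; ring

/-- Uniform stability, applied once per sample, bounds the loss difference for arbitrary training
sets. -/
theorem UniformlyStable.abs_loss_sub_le {A : (Fin N → Sample X p) → H} {β : ℝ}
    (hst : UniformlyStable ℓ A β) (S S' : Fin N → Sample X p) (s : Sample X p) :
    |loss ℓ (A S) s - loss ℓ (A S') s| ≤ N * β := by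
  have h (I : Finset (Fin N)) : ∀ T : Fin N → Sample X p, (∀ j ∉ I, T j = S' j) →
      |loss ℓ (A T) s - loss ℓ (A S') s| ≤ I.card * β := by
    induction I using Finset.induction_on with
    | empty =>
      intro T hT
      rw [show T = S' from funext fun j => hT j (by simp)]
      simp
    | insert i I hi ih =>
      intro T hT
      have h1 := hst i T (Function.update T i (S' i)) (fun j hj => Function.update_of_ne hj _ _) s
      have h2 := ih (Function.update T i (S' i)) fun j hj => by
        rcases eq_or_ne j i with rfl | hji
        · simp
        · rw [Function.update_of_ne hji]
          exact hT j (by simp [hji, hj])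
      rw [Finset.card_insert_of_notMem hi]
      push_cast
      refine (abs_sub_le _ (loss ℓ (A (Function.update T i (S' i))) s) _).trans ?_
      linarith
  simpa using h Finset.univ S (by simp)

/-- The loss of a fixed classifier is bounded. -/
theorem IsAdmissible.exists_abs_loss_le [CompleteSpace H] (hσ : IsAdmissible H ℓ σ)
    (hκ : ∀ x : X, scalarKernel H x x ≤ κ ^ 2) (f : H) :
    ∃ C, ∀ s : Sample X p, |loss ℓ f s| ≤ C := by
  refine ⟨|σ| * |κ| * ‖f‖ + ∑ y, |ℓ 0 y|, fun s => ?_⟩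
  have h1 := hσ.abs_loss_sub_le hκ f 0 s
  rw [sub_zero] at h1
  have h2 : |loss ℓ (0 : H) s| ≤ ∑ y, |ℓ 0 y| := by
    simp only [loss, RKHS.coe_zero, Pi.zero_apply]
    exact Finset.single_le_sum (f := fun y => |ℓ 0 y|) (fun _ _ => abs_nonneg _)
      (Finset.mem_univ s.2.2)
  linarith [abs_sub_abs_le_abs_sub (loss ℓ f s) (loss ℓ (0 : H) s)]

/-- Admissibility controls `ℓ` only at values attained by `H`. If some `f x ≠ 0`, scaling `f`
attains every real, so each `ℓ(·, y)` is Lipschitz on `ℝ`; otherwise the loss depends on the label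
alone. -/
theorem IsAdmissible.measurable_loss [MeasurableSpace X] (hσ : IsAdmissible H ℓ σ)
    {A : (Fin N → Sample X p) → H}
    (hmeas : Measurable (fun q : (Fin N → Sample X p) × X => A q.1 q.2)) :
    Measurable (Function.uncurry fun (S : Fin N → Sample X p) (s : Sample X p) =>
      loss ℓ (A S) s) := by
  have hq : Measurable fun q : (Fin N → Sample X p) × Sample X p => (A q.1 q.2.1, q.2.2.2) :=
    (hmeas.comp (measurable_fst.prodMk measurable_snd.fst)).prodMk measurable_snd.snd.snd
  by_cases hzero : ∀ (f : H) (x : X), f x = 0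
  · have hy : Measurable fun y : Label => ℓ 0 y := measurable_of_countable _
    convert hy.comp hq.snd using 1
    funext q
    simp [Function.uncurry, loss, hzero]
  · push Not at hzero
    obtain ⟨f, x, hfx⟩ := hzero
    have hval (r : ℝ) : ((r / f x) • f) x = r := by
      rw [RKHS.coe_smul, Pi.smul_apply, smul_eq_mul, div_mul_cancel₀ _ hfx]
    have hcont (y : Label) : Continuous fun r => ℓ r y := by
      refine (LipschitzWith.of_dist_le_mul (K := σ.toNNReal) fun r r' => ?_).continuous
      have := hσ ((r / f x) • f) ((r' / f x) • f) x x y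
      rw [hval, hval] at this
      rw [Real.dist_eq, Real.dist_eq]
      exact this.trans (mul_le_mul_of_nonneg_right (Real.le_coe_toNNReal σ) (abs_nonneg _))
    have hℓ : Measurable fun r : ℝ × Label => ℓ r.1 r.2 :=
      measurable_from_prod_countable_left fun y => (hcont y).measurable
    exact hℓ.comp hq

end Stability

end StableFair

theorem corollary3p5
    {X H : Type*} [MeasurableSpace X]
    [NormedAddCommGroup H] [InnerProductSpace ℝ H] [CompleteSpace H] [RKHS ℝ H X ℝ]
    {p N a : ℕ} (hN : 0 < N)
    (μ : Measure (StableFair.Sample X p)) [IsProbabilityMeasure μ]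
    (κ σ lam : ℝ) (hlam : 0 < lam)
    -- the kernel satisfies `k(x, x) ≤ κ²`
    (hκ : ∀ x : X, StableFair.scalarKernel H x x ≤ κ ^ 2)
    -- the loss is `σ`-admissible, and convex and differentiable as a function on `H`
    (ℓ : ℝ → StableFair.Label → ℝ)
    (hσ : StableFair.IsAdmissible H ℓ σ)
    (hconv : ∀ s : StableFair.Sample X p,
      ConvexOn ℝ Set.univ (fun f : H => StableFair.loss ℓ f s))
    (hdiff : ∀ s : StableFair.Sample X p,
      Differentiable ℝ (fun f : H => StableFair.loss ℓ f s))
    -- the convex fairness constraint `Ω(f) ≤ 0`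
    (Ω : H → Fin a → ℝ) (hΩ : ConvexOn ℝ Set.univ Ω)
    -- the algorithm returns a minimizer of the regularized program on every training set
    (A : (Fin N → StableFair.Sample X p) → H)
    (hA : ∀ S, StableFair.IsStableFairMinimizer ℓ Ω lam S (A S))
    (hmeas : Measurable (fun q : (Fin N → StableFair.Sample X p) × X => A q.1 q.2)) :
    StableFair.UniformlyStable ℓ A (σ ^ 2 * κ ^ 2 / (lam * N)) ∧
    -- the expectations in the expected generalization gap exist, and the gap is bounded
    ((∀ S, Integrable (fun s => StableFair.loss ℓ (A S) s) μ) ∧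
      Integrable
        (fun S => StableFair.risk ℓ μ (A S) - StableFair.empRisk ℓ S (A S))
        (Measure.pi (fun _ : Fin N => μ)) ∧
      ∫ S, (StableFair.risk ℓ μ (A S) - StableFair.empRisk ℓ S (A S))
          ∂(Measure.pi (fun _ : Fin N => μ))
        ≤ σ ^ 2 * κ ^ 2 / (lam * N)) ∧
    -- the high-probability bound, for losses of learned classifiers with values in `[0, 1]`
    ((∀ S (s : StableFair.Sample X p), StableFair.loss ℓ (A S) s ∈ Set.Icc (0 : ℝ) 1) →
      ∀ δ : ℝ, 0 < δ → δ < 1 →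
        1 - δ ≤ (Measure.pi (fun _ : Fin N => μ)).real
          {S | StableFair.risk ℓ μ (A S) ≤ StableFair.empRisk ℓ S (A S) +
            8 * √((2 * σ ^ 2 * κ ^ 2 / (lam * N) + 1 / N) * Real.log (8 / δ))}) := by
  have hst := StableFair.uniformlyStable_of_isStableFairMinimizer hN hlam hκ hσ hconv hΩ hA
  set β : ℝ := σ ^ 2 * κ ^ 2 / (lam * N) with hβ
  have hβ0 : 0 ≤ β := by positivity
  have hL := hσ.measurable_loss hmeas
  have hup (i : Fin N) (S : Fin N → StableFair.Sample X p) (z s : StableFair.Sample X p) :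
      |StableFair.loss ℓ (A (Function.update S i z)) s - StableFair.loss ℓ (A S) s| ≤ β := by
    rw [abs_sub_comm]
    exact hst i S _ (fun j hj => Function.update_of_ne hj _ _) s
  -- A uniform bound for integrability: fix a reference training set and replace its `N` samples one
  -- by one.
  obtain ⟨s₀⟩ := μ.nonempty_of_neZero
  obtain ⟨C₀, hC₀⟩ := hσ.exists_abs_loss_le (p := p) hκ (A fun _ => s₀)
  have hC (S : Fin N → StableFair.Sample X p) (s : StableFair.Sample X p) :
      |StableFair.loss ℓ (A S) s| ≤ C₀ + N * β := by
    have h1 := hst.abs_loss_sub_le S (fun _ => s₀) s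
    have h2 := abs_sub_abs_le_abs_sub (StableFair.loss ℓ (A S) s)
      (StableFair.loss ℓ (A fun _ => s₀) s)
    linarith [hC₀ s]
  refine ⟨hst, ⟨fun S => ?_, ?_, ?_⟩, fun h01 δ hδ hδ1 => ?_⟩
  · exact StableFair.integrable_of_measurable_of_abs_le (hL.comp measurable_prodMk_left) (hC S)
  · exact StableFair.integrable_of_measurable_of_abs_le (StableFair.measurable_genGap (μ := μ) hL)
      (StableFair.abs_genGap_le hN hC)
  · exact StableFair.integral_genGap_le hN hL hC hup
  · have h := StableFair.one_sub_le_measureReal_genGap_le (μ := μ) hN hL h01 hup hβ0 hδ hδ1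
    have he : 2 * σ ^ 2 * κ ^ 2 / (lam * N) = 2 * β := by rw [hβ]; ring
    rw [he]
    convert h using 3
    funext S
    simp only [StableFair.genGap, StableFair.risk, StableFair.empRisk, tsub_le_iff_left]
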